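/- Conventions. A pure state of $N$ parties is a vector in $(\mathbb C^{\kappa})^{\otimes N}$. For $N$-partite states $|\psi\rangle,|\phi\rangle$ write $|\psi\rangle\to|\phi\rangle$ (convertibility by SLOCC) if there are linear operators $A_1,\dots,A_N$ on the local spaces and a scalar $c\neq 0$ with $(A_1\otimes\cdots\otimes A_N)|\psi\rangle=c\,|\phi\rangle$. The state $|\psi\rangle^{\otimes n}$ is regarded as $N$-partite, the $i$-th party holding the $i$-th subsystem of each copy. Put $$R(|\psi\rangle,|\phi\rangle)=\sup\Big\{\frac mn : m\ge 0,\ n\geq 1,\ |\psi\rangle^{\otimes n}\to|\phi\rangle^{\otimes m}\Big\}\in[0,\infty].$$ Let $|GHZ\rangle_N=\tfrac1{\sqrt2}(|0\cdots0\rangle+|1\cdots1\rangle)$. For integers $j_1,\dots,j_d\ge 1$ with $N=\sum_{i=1}^d j_i$, the $N$-partite Dicke state $|D(j_1,\dots,j_d)\rangle$ is the normalization of $P_{\mathrm{sym}}\big(|1\rangle^{\otimes j_1}\otimes\cdots\otimes|d\rangle^{\otimes j_d}\big)$, where $P_{\mathrm{sym}}=\frac1{N!}\sum_{\pi\in S_N}U_\pi$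 is the projection onto the fully symmetric subspace of $(\mathbb C^d)^{\otimes N}$. Theorem 2. Let $d\ge1$, let $j_1\ge\cdots\ge j_d\ge1$ be integers and $N=\sum_{i=1}^d j_i$. Then, with the convention $0^{-1}=\infty$ (which only matters for $d=1$): 1. $$R\big(|GHZ\rangle_N,|D(j_1,\dots,j_d)\rangle\big)\ \ge\ \Big(\sum_{i=2}^d\log_2(j_i+1)\Big)^{-1}.$$ 2. For all integers $m,n\ge0$ with $2^m\ge\prod_{k=2}^d\binom{nj_k+N-1}{N-1}(j_k+1)^n$, one has $|GHZ\rangle_N^{\otimes m}\to|D(j_1,\dots,j_d)\rangle^{\otimes n}$. 3. If $j_1\ge\sum_{i=2}^d j_i$, then equality holds in 1. -/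

import Mathlib

open scoped ENNReal

namespace SLOCC

/-- A (not necessarily normalized) pure state of `N` parties, each holding a system with
computational basis indexed by `κ`, given by its amplitudes in the product basis: `ψ x` is the
coefficient of `|x 0⟩ ⊗ ⋯ ⊗ |x (N-1)⟩`. -/
abbrev State (N : ℕ) (κ : Type) : Type := (Fin N → κ) → ℂ

/-- The product basis state `|x 0⟩ ⊗ ⋯ ⊗ |x (N-1)⟩`. -/
def ket {N : ℕ} {κ : Type} [DecidableEq κ] (x : Fin N → κ) : State N κ := Pi.single x 1

/-- `n` copies of `ψ`, as an `N`-partite state: party `i` holds the `i`-th subsystem of every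
copy, so that its computational basis is indexed by `Fin n → κ`. -/
def copies {N : ℕ} {κ : Type} (ψ : State N κ) (n : ℕ) : State N (Fin n → κ) :=
  fun x => ∏ k, ψ (fun i => x i k)

/-- The action of the product operator `A 0 ⊗ ⋯ ⊗ A (N-1)` on a state. -/
def applyLocal {N : ℕ} {κ κ' : Type} [Fintype κ] (A : Fin N → Matrix κ' κ ℂ) (ψ : State N κ) :
    State N κ' :=
  fun y => ∑ x, (∏ i, A i (y i) (x i)) * ψ x

/-- `ψ` can be transformed to `φ` by SLOCC: some product of local operators maps `ψ` to `φ`, up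
to a nonzero normalization factor. -/
def Transforms {N : ℕ} {κ κ' : Type} [Fintype κ] (ψ : State N κ) (φ : State N κ') : Prop :=
  ∃ (A : Fin N → Matrix κ' κ ℂ) (c : ℂ), c ≠ 0 ∧ applyLocal A ψ = c • φ

/-- The SLOCC entanglement transformation rate `sup {m / n : ψ^{⊗ n} → φ^{⊗ m}}`, as an element
of `[0, ∞]`. -/
noncomputable def rate {N : ℕ} {κ κ' : Type} [Fintype κ] (ψ : State N κ) (φ : State N κ') :
    ℝ≥0∞ :=
  sSup {r | ∃ m n : ℕ, 0 < n ∧ Transforms (copies ψ n) (copies φ m) ∧ r = (m : ℝ≥0∞) / n}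

/-- The `N`-partite GHZ state `(|0⋯0⟩ + |1⋯1⟩) / √2`. -/
noncomputable def ghz (N : ℕ) : State N (Fin 2) :=
  ((Real.sqrt 2 : ℝ) : ℂ)⁻¹ • (ket (fun _ => 0) + ket (fun _ => 1))

/-- The projection `(1 / N!) ∑_π U_π` onto the fully symmetric subspace. -/
noncomputable def symProj {N : ℕ} {κ : Type} (ψ : State N κ) : State N κ :=
  fun x => (Nat.factorial N : ℂ)⁻¹ * ∑ π : Equiv.Perm (Fin N), ψ (fun i => x (π i))

/-- The word consisting of `j 0` letters `0`, then `j 1` letters `1`, and so on. -/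
def blockWord {d : ℕ} (j : Fin d → ℕ) : Fin (∑ i, j i) → Fin d :=
  fun p => (finSigmaFinEquiv.symm p).1

/-- The normalized Dicke state `|D(j 0, …, j (d-1))⟩`, of `N = ∑ i, j i` parties. The projected
product state has norm `(N choose j 0, …, j (d-1))^{-1/2}`, whence the prefactor. -/
noncomputable def dicke {d : ℕ} (j : Fin d → ℕ) : State (∑ i, j i) (Fin d) :=
  ((Real.sqrt (Nat.multinomial Finset.univ j) : ℝ) : ℂ) • symProj (ket (blockWord j))

end SLOCC

namespace SLOCC

/-! ### The GHZ state as a unit tensor -/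

/-! Up to a scalar, `m` GHZ states form the unit tensor with `2 ^ m` diagonal terms, so they yield
`φ` as soon as `φ` is proportional to a sum of at most `2 ^ m` product states
(`transforms_copies_ghz`).

Lower bound: a Dicke state is proportional to the indicator that each nonzero letter `k` occurs `j
k` times; letter `0` then costs nothing. Over `n` copies, the condition "count equal to `j k` in
every copy" is split in two: every count is `-1` modulo `j k + 1`, hence at least `j k`, and the
total over the copies is `n * j k`. A root-of-unity filter expresses the first with `(j k + 1) ^ n`
product terms. The second is a sum over the ways to distribute the total among the `N` parties, a
binomial number of terms, polynomial in `n` and so invisible in the rate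
(`sum_letter_decomposition`).

Upper bound: if the zeroth block is large enough to hold all other letters, flattening it against
the remaining parties exhibits an identity matrix of size `∏ (j k + 1)`. Copies raise this size to a
power, while the flattening rank obtainable from `n` GHZ states is at most `2 ^ n`. -/

theorem copies_smul {N : ℕ} {κ : Type} (c : ℂ) (ψ : State N κ) (n : ℕ) :
    copies (c • ψ) n = c ^ n • copies ψ n := by
  funext x
  simp [copies, Finset.prod_mul_distrib]

theorem ghz_apply {N : ℕ} (x : Fin N → Fin 2) :
    ghz N x = ((Real.sqrt 2 : ℝ) : ℂ)⁻¹ * ∑ b : Fin 2, if x = fun _ => b then 1 else 0 := by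
  simp only [ghz, ket, Pi.smul_apply, Pi.add_apply, Pi.single_apply, smul_eq_mul, Fin.sum_univ_two]

theorem copies_ghz_apply {N : ℕ} (m : ℕ) (x : Fin N → Fin m → Fin 2) :
    copies (ghz N) m x = (((Real.sqrt 2 : ℝ) : ℂ)⁻¹) ^ m *
      ∑ z : Fin m → Fin 2, if x = fun _ => z then 1 else 0 := by
  simp only [copies, ghz_apply, Finset.prod_mul_distrib, Finset.prod_const, Finset.card_univ,
    Fintype.card_fin, Finset.prod_univ_sum, Fintype.piFinset_univ]
  congr 1
  refine Finset.sum_congr rfl fun z _ => ?_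
  rw [Finset.prod_ite_zero]
  simp only [Finset.prod_const_one, Finset.mem_univ, forall_const]
  congr 1
  simp only [funext_iff, eq_iff_iff]
  exact forall_comm

/-- Only tuples in which all parties hold the same bit string `z` have nonzero amplitude, so the sum
over tuples collapses to a sum over `z`. -/
theorem applyLocal_copies_ghz {N m : ℕ} {κ : Type} (A : Fin N → Matrix κ (Fin m → Fin 2) ℂ)
    (y : Fin N → κ) :
    applyLocal A (copies (ghz N) m) y =
      (((Real.sqrt 2 : ℝ) : ℂ)⁻¹) ^ m * ∑ z, ∏ i, A i (y i) z := by
  simp only [applyLocal, copies_ghz_apply, Finset.mul_sum, mul_ite, mul_one, mul_zero]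
  rw [Finset.sum_comm]
  refine Finset.sum_congr rfl fun z _ => ?_
  rw [Finset.sum_ite_eq' Finset.univ (fun _ => z)]
  simp [mul_comm]

/-- A state that is, up to a factor, a sum of at most `2 ^ m` product states can be obtained from
`m` GHZ states. -/
theorem transforms_copies_ghz {N m : ℕ} (hN : 0 < N) {κ ι : Type} [Fintype ι] (φ : State N κ)
    (hι : Fintype.card ι ≤ 2 ^ m) (w : ι → ℂ) (v : ι → Fin N → κ → ℂ) (c : ℂ) (hc : c ≠ 0)
    (h : ∀ y, ∑ t, w t * ∏ i, v t i (y i) = c * φ y) :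
    Transforms (copies (ghz N) m) φ := by
  obtain ⟨f⟩ : Nonempty (ι ↪ (Fin m → Fin 2)) :=
    Function.Embedding.nonempty_of_card_le (by simpa using hι)
  let o : Fin N := ⟨0, hN⟩
  -- Each term occupies one bit string via `f`. The weight `w t` is charged to the single party `o`,
  -- and bit strings outside the range of `f` are sent to zero.
  refine ⟨fun i => Matrix.of fun y z =>
    Function.extend f (fun t => (if i = o then w t else 1) * v t i y) 0 z,
    (((Real.sqrt 2 : ℝ) : ℂ)⁻¹) ^ m * c, ?_, ?_⟩
  · refine mul_ne_zero (pow_ne_zero _ (inv_ne_zero ?_)) hc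
    simp
  · funext y
    rw [applyLocal_copies_ghz, Pi.smul_apply, smul_eq_mul, mul_assoc, ← h]
    congr 1
    simp only [Matrix.of_apply]
    symm
    refine Finset.sum_of_injOn f f.injective.injOn (by simp) (fun z _ hz => ?_) (fun t _ => ?_)
    · refine Finset.prod_eq_zero (Finset.mem_univ o) ?_
      rw [Function.extend_apply']
      · rfl
      · simpa using hz
    · simp only [f.injective.extend_apply, Finset.prod_mul_distrib, Finset.prod_ite_eq',
        Finset.mem_univ, if_true]

/-! ### Amplitudes of Dicke states -/

/-- The unnormalized Dicke state: the indicator of the words in which the letter `k + 1` occurs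
`j (k + 1)` times, for every `k`. The number of letters `0` is then determined. -/
def typeIndicator {d : ℕ} (N : ℕ) (j : Fin (d + 1) → ℕ) : State N (Fin (d + 1)) :=
  fun x => ∏ k : Fin d, if (Finset.univ.filter fun i => x i = k.succ).card = j k.succ then 1 else 0

theorem card_blockWord_fiber {d : ℕ} (j : Fin d → ℕ) (k : Fin d) :
    (Finset.univ.filter fun i => blockWord j i = k).card = j k := by
  rw [← Fintype.card_subtype, ← Fintype.card_fin (j k)]
  refine Fintype.card_congr ?_
  refine (Equiv.subtypeEquiv (q := fun s => s.1 = k) finSigmaFinEquiv.symm fun _ => Iff.rfl).trans ?_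
  exact Equiv.sigmaSubtype k

theorem card_fiber_eq_of_succ {d : ℕ} (j : Fin (d + 1) → ℕ) (x : Fin (∑ i, j i) → Fin (d + 1))
    (h : ∀ k : Fin d, (Finset.univ.filter fun i => x i = k.succ).card = j k.succ)
    (k : Fin (d + 1)) : (Finset.univ.filter fun i => x i = k).card = j k := by
  refine Fin.cases ?_ h k
  have h1 := Finset.card_eq_sum_card_fiberwise (s := Finset.univ) (t := Finset.univ) (f := x)
    (by simp)
  rw [Finset.card_univ, Fintype.card_fin] at h1
  have h2 := h1.trans (Fin.sum_univ_succ _)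
  rw [Finset.sum_congr rfl fun k _ => h k] at h2
  exact (Nat.add_right_cancel ((Fin.sum_univ_succ j).symm.trans h2)).symm

/-- Two words with the same letter counts differ by a permutation of the positions. -/
theorem exists_perm_of_card_fiber_eq {N : ℕ} {κ : Type} [DecidableEq κ] (x y : Fin N → κ)
    (h : ∀ k, (Finset.univ.filter fun i => x i = k).card =
      (Finset.univ.filter fun i => y i = k).card) :
    ∃ σ : Equiv.Perm (Fin N), ∀ i, x (σ i) = y i := by
  have e : ∀ k, Nonempty ({i // y i = k} ≃ {i // x i = k}) := fun k =>
    Fintype.card_eq.1 (by rw [Fintype.card_subtype, Fintype.card_subtype, h])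
  exact ⟨Equiv.ofFiberEquiv fun k => (e k).some, Equiv.ofFiberEquiv_map _⟩

theorem typeIndicator_eq_one {d N : ℕ} {j : Fin (d + 1) → ℕ} {x : Fin N → Fin (d + 1)}
    (h : ∀ k : Fin d, (Finset.univ.filter fun i => x i = k.succ).card = j k.succ) :
    typeIndicator N j x = 1 :=
  Finset.prod_eq_one fun k _ => if_pos (h k)

theorem typeIndicator_eq_zero {d N : ℕ} {j : Fin (d + 1) → ℕ} {x : Fin N → Fin (d + 1)}
    (k : Fin d) (h : (Finset.univ.filter fun i => x i = k.succ).card ≠ j k.succ) :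
    typeIndicator N j x = 0 :=
  Finset.prod_eq_zero (Finset.mem_univ k) (if_neg h)

theorem dicke_eq_smul_typeIndicator {d : ℕ} (j : Fin (d + 1) → ℕ) :
    ∃ C : ℂ, C ≠ 0 ∧ dicke j = C • typeIndicator (∑ i, j i) j := by
  classical
  let s : Finset (Equiv.Perm (Fin (∑ i, j i))) :=
    Finset.univ.filter fun ρ => (fun i => blockWord j (ρ i)) = blockWord j
  have hs : (s.card : ℂ) ≠ 0 := by
    rw [Nat.cast_ne_zero, ← Nat.pos_iff_ne_zero, Finset.card_pos]
    exact ⟨1, by simp [s]⟩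
  have hm : ((Real.sqrt (Nat.multinomial Finset.univ j) : ℝ) : ℂ) ≠ 0 := by
    rw [Complex.ofReal_ne_zero, Real.sqrt_ne_zero (Nat.cast_nonneg _), Nat.cast_ne_zero]
    exact (Nat.multinomial_pos _ _).ne'
  refine ⟨((Real.sqrt (Nat.multinomial Finset.univ j) : ℝ) : ℂ) *
    ((Nat.factorial (∑ i, j i) : ℂ)⁻¹ * s.card), ?_, ?_⟩
  · refine mul_ne_zero hm (mul_ne_zero (inv_ne_zero ?_) hs)
    exact Nat.cast_ne_zero.2 (Nat.factorial_ne_zero _)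
  funext x
  simp only [dicke, symProj, ket, Pi.smul_apply, smul_eq_mul, Pi.single_apply, mul_assoc,
    Finset.sum_boole]
  congr 2
  by_cases hx : ∀ k : Fin d, (Finset.univ.filter fun i => x i = k.succ).card = j k.succ
  · rw [typeIndicator_eq_one hx, mul_one]
    congr 1
    obtain ⟨σ, hσ⟩ := exists_perm_of_card_fiber_eq x (blockWord j) fun k => by
      rw [card_fiber_eq_of_succ j x hx, card_blockWord_fiber]
    -- The permutations carrying `x` to the block word form the coset `σ * s` of its stabilizer, so
    -- their number does not depend on `x`.
    refine (Finset.card_equiv (Equiv.mulLeft σ) fun ρ => ?_).symm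
    simp [s, hσ]
  · push Not at hx
    obtain ⟨k, hk⟩ := hx
    rw [typeIndicator_eq_zero k hk, mul_zero, Nat.cast_eq_zero, Finset.card_eq_zero,
      Finset.filter_eq_empty_iff]
    intro π _ hπ
    refine hk ?_
    rw [← card_blockWord_fiber j k.succ, ← hπ]
    exact (Finset.card_equiv π fun i => by simp).symm

/-! ### Product decompositions of copies of Dicke states -/

theorem card_piAntidiag_univ (N n : ℕ) (hN : 0 < N) :
    (Finset.piAntidiag (Finset.univ : Finset (Fin N)) n).card = (n + (N - 1)).choose (N - 1) := by
  have h : (Finset.piAntidiag (Finset.univ : Finset (Fin N)) n).card =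
      (Finset.finsuppAntidiag (Finset.univ : Finset (Fin N)) n).card := by
    refine (Finset.card_equiv Finsupp.equivFunOnFinite fun f => ?_).symm
    simp
  rw [h, Finset.card_finsuppAntidiag_nat_eq_choose, Finset.card_univ, Fintype.card_fin,
    show N + n - 1 = n + (N - 1) by omega, Nat.choose_symm_add]

theorem sum_rootOfUnity_pow {q : ℕ} {ω : ℂ} (hω : IsPrimitiveRoot ω q) (r : ℕ) :
    ∑ l : Fin q, (ω ^ (l : ℕ)) ^ r = if q ∣ r then (q : ℂ) else 0 := by
  have h1 : ∀ l : Fin q, (ω ^ (l : ℕ)) ^ r = (ω ^ r) ^ (l : ℕ) := fun l => by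
    rw [← pow_mul, ← pow_mul, mul_comm]
  simp only [h1]
  rw [Fin.sum_univ_eq_sum_range fun l => (ω ^ r) ^ l]
  split_ifs with h
  · simp [(hω.pow_eq_one_iff_dvd r).2 h]
  · have h2 : ω ^ r ≠ 1 := fun e => h ((hω.pow_eq_one_iff_dvd r).1 e)
    rw [geom_sum_eq h2, ← pow_mul, mul_comm r q, pow_mul, hω.pow_eq_one, one_pow, sub_self,
      zero_div]

/-- Sum over compositions of the indicator that a tuple equals the composition. -/
theorem sum_piAntidiag_prod_ite {N : ℕ} (M : ℕ) (c : Fin N → ℕ) :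
    ∑ a : Finset.piAntidiag (Finset.univ : Finset (Fin N)) M,
      ∏ i, (if c i = a.1 i then (1 : ℂ) else 0) = if ∑ i, c i = M then 1 else 0 := by
  rw [Finset.sum_coe_sort (Finset.piAntidiag (Finset.univ : Finset (Fin N)) M)
    fun a => ∏ i, (if c i = a i then (1 : ℂ) else 0)]
  simp only [Finset.prod_ite_zero, Finset.prod_const_one, Finset.mem_univ, forall_const,
    ← funext_iff, Finset.sum_ite_eq, Finset.mem_piAntidiag]
  simp

/-- Counts that are all congruent to `-1` modulo `j + 1` and average to `j` are all equal to `j`. -/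
theorem forall_eq_iff_dvd_and_sum {n j : ℕ} (r : Fin n → ℕ) :
    (∀ c, r c = j) ↔ (∀ c, j + 1 ∣ r c + 1) ∧ ∑ c, r c = n * j := by
  constructor
  · intro h
    simp [h]
  · rintro ⟨h, hs⟩ c
    -- A positive multiple of `j + 1` is at least `j + 1`; with every count at least `j`, the
    -- prescribed total leaves no slack.
    have hle : ∀ c ∈ Finset.univ, j ≤ r c := fun c _ => by
      have := Nat.le_of_dvd (Nat.succ_pos _) (h c)
      omega
    have := (Finset.sum_eq_sum_iff_of_le hle).1 (by simp [hs])
    exact (this c (Finset.mem_univ c)).symm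

/-- The decomposition for a single letter `k`, in terms of the relation "party `i` holds the letter
`k` in copy `c`". -/
theorem sum_letter_decomposition {N n j : ℕ} {ω : ℂ} (hω : IsPrimitiveRoot ω (j + 1))
    (p : Fin N → Fin n → Prop) [∀ i c, Decidable (p i c)] :
    ∑ t : (Fin n → Fin (j + 1)) × Finset.piAntidiag (Finset.univ : Finset (Fin N)) (n * j),
      (∏ c, ω ^ (t.1 c : ℕ)) * ∏ i, ((∏ c, if p i c then ω ^ (t.1 c : ℕ) else 1) *
        if (Finset.univ.filter fun c => p i c).card = t.2.1 i then 1 else 0) =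
    ((j + 1 : ℕ) : ℂ) ^ n *
      ∏ c, if (Finset.univ.filter fun i => p i c).card = j then 1 else 0 := by
  -- Root-of-unity filter in each copy. The weight `ω ^ l` adds one to the exponent, so the filter
  -- selects counts that are `-1`, not `0`, modulo `j + 1`.
  have hl : ∑ l : Fin n → Fin (j + 1),
      (∏ c, ω ^ (l c : ℕ)) * ∏ i : Fin N, ∏ c, (if p i c then ω ^ (l c : ℕ) else 1) =
      ∏ c, if j + 1 ∣ (Finset.univ.filter fun i => p i c).card + 1
        then ((j + 1 : ℕ) : ℂ) else 0 := by
    simp only [← sum_rootOfUnity_pow hω, Finset.prod_univ_sum,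
      Fintype.piFinset_univ]
    refine Finset.sum_congr rfl fun l _ => ?_
    rw [Finset.prod_comm, ← Finset.prod_mul_distrib]
    refine Finset.prod_congr rfl fun c _ => ?_
    rw [← Finset.prod_filter, Finset.prod_const, pow_succ']
  have hcomm : ∑ i, (Finset.univ.filter fun c => p i c).card =
      ∑ c, (Finset.univ.filter fun i => p i c).card := by
    simp only [Finset.card_filter]
    exact Finset.sum_comm
  simp only [Finset.prod_mul_distrib, ← mul_assoc]
  rw [Fintype.sum_prod_type]
  simp only [← Finset.mul_sum, sum_piAntidiag_prod_ite]
  rw [← Finset.sum_mul, hl, hcomm, Finset.prod_ite_zero, Finset.prod_ite_zero]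
  simp only [Finset.mem_univ, forall_const, Finset.prod_const, Finset.card_univ, Fintype.card_fin,
    one_pow, forall_eq_iff_dvd_and_sum (fun c => (Finset.univ.filter fun i => p i c).card)]
  by_cases h1 : ∀ c, j + 1 ∣ (Finset.univ.filter fun i => p i c).card + 1 <;>
    simp [h1]

/-- Multiplying the single-letter decompositions over all nonzero letters and expanding gives one
product state per family of single-letter indices, which the left side of `h` counts. -/
theorem transforms_copies_typeIndicator {d N : ℕ} (hN : 0 < N) (j : Fin (d + 1) → ℕ) (m n : ℕ)
    (h : ∏ k : Fin d, ((n * j k.succ + (N - 1)).choose (N - 1) * (j k.succ + 1) ^ n) ≤ 2 ^ m) :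
    Transforms (copies (ghz N) m) (copies (typeIndicator N j) n) := by
  have hω : ∀ k : Fin d, IsPrimitiveRoot
      (Complex.exp (2 * Real.pi * Complex.I / ((j k.succ + 1 : ℕ) : ℂ))) (j k.succ + 1) :=
    fun k => Complex.isPrimitiveRoot_exp _ (Nat.succ_ne_zero _)
  generalize hω' : (fun k : Fin d =>
    Complex.exp (2 * Real.pi * Complex.I / ((j k.succ + 1 : ℕ) : ℂ))) = ω
  replace hω : ∀ k : Fin d, IsPrimitiveRoot (ω k) (j k.succ + 1) := by
    rw [← hω']; exact hω
  refine transforms_copies_ghz hN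
    (ι := (k : Fin d) → (Fin n → Fin (j k.succ + 1)) ×
      Finset.piAntidiag (Finset.univ : Finset (Fin N)) (n * j k.succ)) _ ?_
    (fun t => ∏ k, ∏ c, ω k ^ ((t k).1 c : ℕ))
    (fun t i y => ∏ k, ((∏ c, if y c = k.succ then ω k ^ ((t k).1 c : ℕ) else 1) *
        if (Finset.univ.filter fun c => y c = k.succ).card = (t k).2.1 i then 1 else 0))
    (∏ k : Fin d, ((j k.succ + 1 : ℕ) : ℂ) ^ n) ?_ fun y => ?_
  · refine le_trans (le_of_eq ?_) h
    simp [card_piAntidiag_univ _ _ hN, Fintype.card_pi, mul_comm]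
  · exact Finset.prod_ne_zero_iff.2 fun k _ => pow_ne_zero _ (Nat.cast_ne_zero.2 (by omega))
  · simp only [copies, typeIndicator]
    rw [Finset.prod_comm (s := (Finset.univ : Finset (Fin n))), ← Finset.prod_mul_distrib]
    simp only [← sum_letter_decomposition (hω _) (fun i c => y i c = Fin.succ _)]
    rw [Finset.prod_univ_sum, Fintype.piFinset_univ]
    refine Finset.sum_congr rfl fun t _ => ?_
    rw [Finset.prod_comm (s := (Finset.univ : Finset (Fin N))), ← Finset.prod_mul_distrib]

theorem Transforms.smul_right {N : ℕ} {κ κ' : Type} [Fintype κ] {ψ : State N κ}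
    {φ : State N κ'} {c : ℂ} (hc : c ≠ 0) (h : Transforms ψ φ) : Transforms ψ (c • φ) := by
  obtain ⟨A, b, hb, hA⟩ := h
  exact ⟨A, b * c⁻¹, mul_ne_zero hb (inv_ne_zero hc), by rw [hA, smul_smul, inv_mul_cancel_right₀ hc]⟩

theorem transforms_copies_dicke {d : ℕ} (j : Fin (d + 1) → ℕ) (hN : 0 < ∑ i, j i) (m n : ℕ)
    (h : ∏ k : Fin d, ((n * j k.succ + ((∑ i, j i) - 1)).choose ((∑ i, j i) - 1)
      * (j k.succ + 1) ^ n) ≤ 2 ^ m) :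
    Transforms (copies (ghz (∑ i, j i)) m) (copies (dicke j) n) := by
  obtain ⟨C, hC, hD⟩ := dicke_eq_smul_typeIndicator j
  rw [hD, copies_smul]
  exact (transforms_copies_typeIndicator hN j m n h).smul_right (pow_ne_zero _ hC)

/-! ### The flattening bound -/

/-- If `m` GHZ states can be transformed to a state having an identity matrix of size `ι` as a
submatrix of its flattening along the bipartition `S`, then `ι` has at most `2 ^ m` elements. -/
theorem card_le_of_transforms_copies_ghz {N m : ℕ} {κ ι : Type} [Fintype ι] [DecidableEq ι]
    {φ : State N κ} (h : Transforms (copies (ghz N) m) φ) (S : Fin N → Prop) [DecidablePred S]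
    (u v : ι → Fin N → κ)
    (hφ : ∀ a b, φ (fun i => if S i then u a i else v b i) = if a = b then 1 else 0) :
    Fintype.card ι ≤ 2 ^ m := by
  obtain ⟨A, c, hc, hA⟩ := h
  -- Every amplitude is a sum over GHZ branches `z` of a factor from the parties in `S` times a
  -- factor from the others, so the identity factors through dimension `2 ^ m`.
  let L : Matrix ι (Fin m → Fin 2) ℂ := Matrix.of fun a z =>
    c⁻¹ * (((Real.sqrt 2 : ℝ) : ℂ)⁻¹) ^ m * ∏ i with S i, A i (u a i) z
  let R : Matrix (Fin m → Fin 2) ι ℂ := Matrix.of fun z b => ∏ i with ¬ S i, A i (v b i) z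
  have hLR : L * R = 1 := by
    ext a b
    have h1 := congrFun hA (fun i => if S i then u a i else v b i)
    rw [applyLocal_copies_ghz, Pi.smul_apply, smul_eq_mul, hφ] at h1
    rw [Matrix.one_apply, ← inv_mul_cancel_left₀ hc (if a = b then (1 : ℂ) else 0), ← h1,
      Matrix.mul_apply, Finset.mul_sum, Finset.mul_sum]
    refine Finset.sum_congr rfl fun z _ => ?_
    simp only [L, R, Matrix.of_apply]
    rw [← Finset.prod_filter_mul_prod_filter_not Finset.univ S, mul_assoc, mul_assoc]
    congr 3
    · refine Finset.prod_congr rfl fun i hi => ?_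
      rw [if_pos (Finset.mem_filter.1 hi).2]
    · refine Finset.prod_congr rfl fun i hi => ?_
      rw [if_neg (Finset.mem_filter.1 hi).2]
  calc Fintype.card ι = (1 : Matrix ι ι ℂ).rank := (Matrix.rank_one).symm
    _ ≤ L.rank := by rw [← hLR]; exact Matrix.rank_mul_le_left L R
    _ ≤ Fintype.card (Fin m → Fin 2) := Matrix.rank_le_card_width L
    _ = 2 ^ m := by simp

theorem card_sigma_filter {d : ℕ} (J : Fin d → ℕ) (P : (Σ k, Fin (J k)) → Prop) [DecidablePred P]
    (k : Fin d) :
    (Finset.univ.filter fun s : Σ k, Fin (J k) => (if P s then s.1.succ else 0) = k.succ).card =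
      (Finset.univ.filter fun p : Fin (J k) => P ⟨k, p⟩).card := by
  have h : ∀ s : Σ k, Fin (J k),
      ((if P s then s.1.succ else 0) = k.succ) ↔ (s.1 = k ∧ P s) := by
    intro s
    split_ifs with hs
    · simp [hs]
    · simp [hs, (Fin.succ_ne_zero k).symm]
  simp only [h, Finset.card_filter, Fintype.sum_sigma]
  rw [Finset.sum_eq_single k]
  · simp
  · intro k' _ hk'
    simp [hk']
  · simp

/-- The letters held in a flattening by the parties outside the zeroth block. -/
def outerWord {d : ℕ} (j : Fin (d + 1) → ℕ) (a : (k : Fin d) → Fin (j k.succ + 1)) :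
    (Σ k : Fin d, Fin (j k.succ)) → Fin (d + 1) :=
  fun s => if s.2.1 < (a s.1).1 then s.1.succ else 0

/-- The letters complementary to those of `outerWord`. -/
def innerWord {d : ℕ} (j : Fin (d + 1) → ℕ) (b : (k : Fin d) → Fin (j k.succ + 1)) :
    (Σ k : Fin d, Fin (j k.succ)) → Fin (d + 1) :=
  fun s => if (b s.1).1 ≤ s.2.1 then s.1.succ else 0

theorem card_outerWord {d : ℕ} (j : Fin (d + 1) → ℕ) (a : (k : Fin d) → Fin (j k.succ + 1))
    (k : Fin d) :
    (Finset.univ.filter fun s => outerWord j a s = k.succ).card = a k := by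
  have h := card_sigma_filter (fun k : Fin d => j k.succ) (fun s => s.2.1 < (a s.1).1) k
  refine h.trans ?_
  dsimp only
  rw [Fin.card_filter_val_lt]
  have := (a k).2
  omega

theorem card_innerWord {d : ℕ} (j : Fin (d + 1) → ℕ) (b : (k : Fin d) → Fin (j k.succ + 1))
    (k : Fin d) :
    (Finset.univ.filter fun s => innerWord j b s = k.succ).card = j k.succ - b k := by
  have h := card_sigma_filter (fun k : Fin d => j k.succ) (fun s => (b s.1).1 ≤ s.2.1) k
  refine h.trans ?_
  dsimp only
  have h1 := Finset.card_filter_add_card_filter_not (s := (Finset.univ : Finset (Fin (j k.succ))))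
    fun p => p.1 < (b k).1
  rw [Fin.card_filter_val_lt, Finset.card_univ, Fintype.card_fin] at h1
  simp only [not_lt] at h1
  have := (b k).2
  omega

/-- The words that exhibit an identity submatrix in the flattening of a Dicke state. -/
theorem exists_flattening_words {d : ℕ} (j : Fin (d + 1) → ℕ) (h : ∑ k : Fin d, j k.succ ≤ j 0) :
    ∃ (S : Fin (∑ i, j i) → Prop) (_ : DecidablePred S)
      (u v : ((k : Fin d) → Fin (j k.succ + 1)) → Fin (∑ i, j i) → Fin (d + 1)),
      ∀ a b, typeIndicator (∑ i, j i) j (fun i => if S i then u a i else v b i) =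
        if a = b then 1 else 0 := by
  -- The size hypothesis enters here: the zeroth block has room for a copy of all positions outside
  -- it, on which the complementary word is written, padded by letter `0`.
  obtain ⟨e⟩ : Nonempty ((Σ k : Fin d, Fin (j k.succ)) ↪ Fin (j 0)) :=
    Function.Embedding.nonempty_of_card_le (by simpa using h)
  let f : Fin (∑ i, j i) ≃ Σ i, Fin (j i) := finSigmaFinEquiv.symm
  let U : ((k : Fin d) → Fin (j k.succ + 1)) → (i : Fin (d + 1)) → Fin (j i) → Fin (d + 1) :=
    fun a => Fin.cases (fun _ => 0) (fun k p => outerWord j a ⟨k, p⟩)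
  let V : ((k : Fin d) → Fin (j k.succ + 1)) → (i : Fin (d + 1)) → Fin (j i) → Fin (d + 1) :=
    fun b => Fin.cases (fun p => Function.extend e (innerWord j b) 0 p) (fun _ _ => 0)
  refine ⟨fun i => (f i).1 ≠ 0, inferInstance, fun a i => U a (f i).1 (f i).2,
    fun b i => V b (f i).1 (f i).2, fun a b => ?_⟩
  -- The count of letter `k` equals `j k.succ` exactly when `a k = b k`; this produces the identity
  -- matrix.
  have hcard : ∀ k : Fin d, (Finset.univ.filter fun i =>
      (if (f i).1 ≠ 0 then U a (f i).1 (f i).2 else V b (f i).1 (f i).2) = k.succ).card =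
      (j k.succ - b k) + a k := by
    intro k
    rw [← card_outerWord j a k, ← card_innerWord j b k]
    simp only [Finset.card_filter]
    rw [f.sum_comp fun s : Σ i, Fin (j i) =>
      if (if s.1 ≠ 0 then U a s.1 s.2 else V b s.1 s.2) = k.succ then 1 else 0,
      Fintype.sum_sigma, Fin.sum_univ_succ, Fintype.sum_sigma
        (f := fun s => if outerWord j a s = k.succ then 1 else 0)]
    congr 1
    simp only [ne_eq, not_true_eq_false, if_false, V, Fin.cases_zero]
    symm
    refine Finset.sum_of_injOn e e.injective.injOn (by simp) (fun z _ hz => ?_) (fun t _ => ?_)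
    · rw [Function.extend_apply']
      · exact if_neg (Fin.succ_ne_zero k).symm
      · simpa using hz
    · rw [e.injective.extend_apply]
  split_ifs with hab
  · refine typeIndicator_eq_one fun k => (hcard k).trans ?_
    have := (b k).2
    rw [hab]
    omega
  · obtain ⟨k, hk⟩ := Function.ne_iff.1 hab
    refine typeIndicator_eq_zero k fun hc => hk (Fin.ext ?_)
    have h1 := (hcard k).symm.trans hc
    have := (b k).2
    omega

theorem prod_pow_le_of_transforms {d : ℕ} (j : Fin (d + 1) → ℕ)
    (h : ∑ k : Fin d, j k.succ ≤ j 0) (m n : ℕ)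
    (hT : Transforms (copies (ghz (∑ i, j i)) n) (copies (dicke j) m)) :
    (∏ k : Fin d, (j k.succ + 1)) ^ m ≤ 2 ^ n := by
  obtain ⟨C, hC, hD⟩ := dicke_eq_smul_typeIndicator j
  have hT' : Transforms (copies (ghz (∑ i, j i)) n) (copies (typeIndicator (∑ i, j i) j) m) := by
    have := hT.smul_right (inv_ne_zero (pow_ne_zero m hC))
    rwa [hD, copies_smul, smul_smul, inv_mul_cancel₀ (pow_ne_zero m hC), one_smul] at this
  obtain ⟨S, _, u, v, huv⟩ := exists_flattening_words j h
  have := card_le_of_transforms_copies_ghz (ι := Fin m → (k : Fin d) → Fin (j k.succ + 1)) hT' S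
    (fun α i c => u (α c) i) (fun β i c => v (β c) i) fun α β => by
      have h1 : ∀ c, (fun i => (if S i then fun c => u (α c) i else fun c => v (β c) i) c) =
          fun i => if S i then u (α c) i else v (β c) i := fun c => by
        funext i
        split_ifs <;> rfl
      simp only [copies, h1, huv, Finset.prod_ite_zero, Finset.prod_const_one, Finset.mem_univ,
        forall_const, funext_iff (f := α)]
  simpa [Fintype.card_pi] using this

/-! ### Rates -/

theorem logb_prod_succ {d : ℕ} (j : Fin (d + 1) → ℕ) :
    Real.logb 2 ((∏ k : Fin d, (j k.succ + 1) : ℕ) : ℝ) =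
      ∑ k : Fin d, Real.logb 2 ((j k.succ : ℝ) + 1) := by
  push_cast
  exact Real.logb_prod _ _ fun k _ => by positivity

theorem rate_le {d : ℕ} (j : Fin (d + 1) → ℕ) (h : ∑ k : Fin d, j k.succ ≤ j 0) :
    rate (ghz (∑ i, j i)) (dicke j) ≤
      (ENNReal.ofReal (∑ k : Fin d, Real.logb 2 ((j k.succ : ℝ) + 1)))⁻¹ := by
  refine sSup_le ?_
  rintro r ⟨m, n, hn, hT, rfl⟩
  have h1 := prod_pow_le_of_transforms j h m n hT
  rw [← logb_prod_succ, ENNReal.le_inv_iff_mul_le, ENNReal.mul_comm_div]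
  generalize hP : ∏ k : Fin d, (j k.succ + 1) = P at *
  have hP0 : 0 < P := hP ▸ Finset.prod_pos fun k _ => Nat.succ_pos _
  have h2 : (m : ℝ) * Real.logb 2 P ≤ n := by
    have h3 : ((P : ℝ) ^ m) ≤ 2 ^ n := by exact_mod_cast h1
    have h4 := Real.logb_le_logb_of_le (b := 2) (by norm_num) (by positivity) h3
    rwa [Real.logb_pow, Real.logb_pow, Real.logb_self_eq_one (by norm_num), mul_one] at h4
  rw [← mul_div_assoc]
  refine ENNReal.div_le_of_le_mul ?_
  rw [one_mul, ← ENNReal.ofReal_natCast, ← ENNReal.ofReal_natCast n,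
    ← ENNReal.ofReal_mul (Nat.cast_nonneg _)]
  exact ENNReal.ofReal_le_ofReal h2

/-- For fixed `r` the binomial grows at most polynomially in `n`, so its logarithm is `o(n)`. -/
theorem tendsto_logb_choose_div (a r : ℕ) :
    Filter.Tendsto (fun n : ℕ => Real.logb 2 ((n * a + r).choose r) / n) Filter.atTop (nhds 0) := by
  have hlog : Filter.Tendsto (fun n : ℕ => Real.log n / n) Filter.atTop (nhds 0) :=
    (Real.isLittleO_log_id_atTop.tendsto_div_nhds_zero).comp tendsto_natCast_atTop_atTop
  have hconst : ∀ C : ℝ, Filter.Tendsto (fun n : ℕ => C / n) Filter.atTop (nhds 0) :=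
    tendsto_const_div_atTop_nhds_zero_nat
  have hub : Filter.Tendsto (fun n : ℕ => (r / Real.log 2) *
      (Real.log n / n + Real.log ((a + r + 1 : ℕ) : ℝ) / n)) Filter.atTop (nhds 0) := by
    simpa using (hlog.add (hconst _)).const_mul (r / Real.log 2)
  refine tendsto_of_tendsto_of_tendsto_of_le_of_le' tendsto_const_nhds hub ?_ ?_
  · refine Filter.Eventually.of_forall fun n => ?_
    refine div_nonneg (Real.logb_nonneg (by norm_num) ?_) (Nat.cast_nonneg _)
    exact_mod_cast Nat.choose_pos (Nat.le_add_left _ _)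
  · filter_upwards [Filter.eventually_ge_atTop 1] with n hn
    have hn0 : (0 : ℝ) < n := by exact_mod_cast hn
    have hle : (n * a + r).choose r ≤ (n * (a + r + 1)) ^ r :=
      (Nat.choose_le_pow _ _).trans (Nat.pow_le_pow_left (by nlinarith) _)
    have hpos : 0 < (n * a + r).choose r := Nat.choose_pos (Nat.le_add_left _ _)
    have h1 : Real.log ((n * a + r).choose r) ≤
        r * (Real.log n + Real.log ((a + r + 1 : ℕ) : ℝ)) := by
      rw [← Real.log_mul hn0.ne' (by positivity), ← Real.log_pow]
      exact Real.log_le_log (by exact_mod_cast hpos) (by exact_mod_cast hle)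
    have hl2 : 0 < Real.log 2 := Real.log_pos (by norm_num)
    calc Real.logb 2 ((n * a + r).choose r) / n
        ≤ (r * (Real.log n + Real.log ((a + r + 1 : ℕ) : ℝ))) / Real.log 2 / n := by
          unfold Real.logb
          gcongr
      _ = _ := by ring

theorem clog_le_logb_add_one {P : ℕ} (hP : 1 ≤ P) : (Nat.clog 2 P : ℝ) ≤ Real.logb 2 P + 1 := by
  rw [← Real.natCeil_logb_natCast]
  refine (Nat.ceil_lt_add_one (Real.logb_nonneg (by norm_num) ?_)).le
  exact_mod_cast hP

theorem le_rate {d : ℕ} (j : Fin (d + 1) → ℕ) (hN : 0 < ∑ i, j i) :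
    (ENNReal.ofReal (∑ k : Fin d, Real.logb 2 ((j k.succ : ℝ) + 1)))⁻¹ ≤
      rate (ghz (∑ i, j i)) (dicke j) := by
  generalize hr : (∑ i, j i) - 1 = r
  let L : ℝ := ∑ k : Fin d, Real.logb 2 ((j k.succ : ℝ) + 1)
  -- An upper bound for the number of GHZ states used per Dicke copy. The `2 / n` pays for rounding
  -- the logarithm up and for one extra GHZ state.
  let b : ℕ → ℝ := fun n =>
    (∑ k : Fin d, Real.logb 2 ((n * j k.succ + r).choose r) / n) + L + 2 / n
  have hb : Filter.Tendsto b Filter.atTop (nhds L) := by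
    have h1 := ((tendsto_finsetSum Finset.univ fun (k : Fin d) _ =>
      tendsto_logb_choose_div (j k.succ) r).add_const L).add
      (tendsto_const_div_atTop_nhds_zero_nat (2 : ℝ))
    simpa [b] using h1
  -- Inversion is continuous on all of `ℝ≥0∞`, so the case `L = 0`, with limit `∞`, needs no
  -- separate treatment.
  have hb' : Filter.Tendsto (fun n => (ENNReal.ofReal (b n))⁻¹) Filter.atTop
      (nhds (ENNReal.ofReal L)⁻¹) :=
    ((ENNReal.continuous_ofReal.tendsto L).comp hb).inv
  refine le_of_tendsto hb' ?_
  filter_upwards [Filter.eventually_ge_atTop 1] with n hn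
  have hn0 : (0 : ℝ) < n := by exact_mod_cast hn
  let P : ℕ := ∏ k : Fin d, ((n * j k.succ + r).choose r * (j k.succ + 1) ^ n)
  have hcpos : ∀ k : Fin d, 0 < (n * j k.succ + r).choose r := fun k =>
    Nat.choose_pos (Nat.le_add_left _ _)
  have hP : 1 ≤ P := Finset.prod_pos fun k _ => Nat.mul_pos (hcpos k) (by positivity)
  have hlogP : Real.logb 2 P =
      (∑ k : Fin d, Real.logb 2 ((n * j k.succ + r).choose r)) + n * L := by
    simp only [P, L, Nat.cast_prod, Finset.mul_sum]
    rw [Real.logb_prod, ← Finset.sum_add_distrib]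
    · refine Finset.sum_congr rfl fun k _ => ?_
      have h1 : (((n * j k.succ + r).choose r : ℕ) : ℝ) ≠ 0 := by exact_mod_cast (hcpos k).ne'
      push_cast
      rw [Real.logb_mul h1 (by positivity), Real.logb_pow]
    · intro k _
      exact_mod_cast (Nat.mul_pos (hcpos k) (by positivity)).ne'
  -- The extra GHZ state keeps the denominator of the rate positive even when `P = 1`.
  have hT : Transforms (copies (ghz (∑ i, j i)) (Nat.clog 2 P + 1)) (copies (dicke j) n) := by
    refine transforms_copies_dicke j hN _ n ?_
    rw [hr]
    exact (Nat.le_pow_clog one_lt_two P).trans (Nat.pow_le_pow_right two_pos (Nat.le_succ _))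
  refine le_trans ?_ (le_sSup ⟨n, Nat.clog 2 P + 1, Nat.succ_pos _, hT, rfl⟩)
  rw [← ENNReal.inv_div (Or.inl (ENNReal.natCast_ne_top _))
    (Or.inl (by exact_mod_cast (by omega : n ≠ 0))), ENNReal.inv_le_inv]
  refine ENNReal.div_le_of_le_mul ?_
  rw [← ENNReal.ofReal_natCast, ← ENNReal.ofReal_natCast n,
    ← ENNReal.ofReal_mul' (Nat.cast_nonneg _)]
  refine ENNReal.ofReal_le_ofReal ?_
  have h1 := clog_le_logb_add_one hP
  have h2 : b n * n = Real.logb 2 P + 2 := by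
    simp only [b, hlogP, ← Finset.sum_div]
    field_simp
  rw [h2]
  push_cast
  linarith

end SLOCC

theorem theorem2 (d : ℕ) (j : Fin (d + 1) → ℕ) (hj : Antitone j) (hpos : ∀ i, 1 ≤ j i) :
    (ENNReal.ofReal (∑ i : Fin d, Real.logb 2 ((j i.succ : ℝ) + 1)))⁻¹
        ≤ SLOCC.rate (SLOCC.ghz (∑ i, j i)) (SLOCC.dicke j) ∧
    (∀ m n : ℕ,
      ∏ k : Fin d, ((n * j k.succ + ((∑ i, j i) - 1)).choose ((∑ i, j i) - 1)
          * (j k.succ + 1) ^ n) ≤ 2 ^ m →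
      SLOCC.Transforms (SLOCC.copies (SLOCC.ghz (∑ i, j i)) m)
        (SLOCC.copies (SLOCC.dicke j) n)) ∧
    (∑ i : Fin d, j i.succ ≤ j 0 →
      SLOCC.rate (SLOCC.ghz (∑ i, j i)) (SLOCC.dicke j)
        = (ENNReal.ofReal (∑ i : Fin d, Real.logb 2 ((j i.succ : ℝ) + 1)))⁻¹) := by
  have hN : 0 < ∑ i, j i :=
    Finset.sum_pos (fun i _ => hpos i) Finset.univ_nonempty
  exact ⟨SLOCC.le_rate j hN, SLOCC.transforms_copies_dicke j hN,
    fun h => le_antisymm (SLOCC.rate_le j h) (SLOCC.le_rate j hN)⟩
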